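/- Let $d \ge 0$ be an integer. A homothetic copy of a set $T\subseteq\mathbb{R}^d$ is a set of the form $\{p^*+\lambda t : t\in T\}$ with $p^*\in\mathbb{R}^d$ and $\lambda>0$. A family $\mathcal{F}$ of real polynomials in $2d$ variables respects a set $X\subseteq\mathbb{R}^d$ if $f(p,q)\neq 0$ for all $f\in\mathcal{F}$ and all pairs of distinct points $p,q\in X$. A cycle of length $\ell\ge 2$ on a set $X$ is a tuple $(T_1,\dots,T_\ell)$ of distinct subsets of $X$ such that there exist distinct elements $x_1,\dots,x_\ell\in X$ with $x_i\in T_i\cap T_{i+1}$ for $1\le i\le \ell-1$ and $x_\ell\in T_\ell\cap T_1$. Theorem. Let $T$ be a finite subset of $\mathbb{R}^d$ of size at least $3$, let $\mathcal{F}$ be a countable family of real polynomials in $2d$ variables that respects $T$, and let $g$ and $k$ be positive integers. Then there exists a finite set $X\subset\mathbb{R}^d$ satisfying the following conditions: 1. $\mathcal{F}$ respects $X$; 2. no tuple of fewer than $g$ homothetic copies of $T$ contained in $X$ forms a cycle on $X$; 3. for every $k$-coloring of $X$ (that is, every map $X\to\{1,\dots,k\}$) there is a homothetic copy of $T$ contained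 in $X$ all of whose points have the same color. -/

import Mathlib

namespace ConstrainedGallai

/-- A homothetic map of `ℝ^d`: a map `p ↦ a + c • p` with `c > 0`. -/
def IsHomotheticMap {d : ℕ} (h : (Fin d → ℝ) → (Fin d → ℝ)) : Prop :=
  ∃ (a : Fin d → ℝ) (c : ℝ), 0 < c ∧ ∀ p, h p = a + c • p

/-- `T'` is a homothetic copy of `T`. -/
def IsHomotheticCopy {d : ℕ} (T' T : Set (Fin d → ℝ)) : Prop :=
  ∃ h : (Fin d → ℝ) → (Fin d → ℝ), IsHomotheticMap h ∧ T' = h '' T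

/-- A family `F` of real polynomials in `2d` variables (the coordinates of `p`, then those of `q`)
respects `X` if no member of `F` vanishes at a pair of distinct points of `X`. -/
def Respects {d : ℕ} (F : Set (MvPolynomial (Fin d ⊕ Fin d) ℝ)) (X : Set (Fin d → ℝ)) : Prop :=
  ∀ f ∈ F, ∀ p ∈ X, ∀ q ∈ X, p ≠ q → MvPolynomial.eval (Sum.elim p q) f ≠ 0

/-- A tuple `(S 0, …, S (ℓ-1))` is a cycle of length `ℓ ≥ 2` on `X`: the `S i` are distinct subsets
of `X`, and there are distinct `x i ∈ X` with `x i ∈ S i ∩ S (i + 1)`, indices taken cyclically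
(`finRotate ℓ` sends `i` to `i + 1` and the last index to `0`). -/
def IsCycle {α : Type*} (X : Set α) {ℓ : ℕ} (S : Fin ℓ → Set α) : Prop :=
  2 ≤ ℓ ∧ Function.Injective S ∧ (∀ i, S i ⊆ X) ∧
    ∃ x : Fin ℓ → α, Function.Injective x ∧ (∀ i, x i ∈ X) ∧
      ∀ i, x i ∈ S i ∩ S (finRotate ℓ i)

/-- The set `S` (a subset of `X`) is monochromatic under the colouring `c` of `X`. -/
def IsMonochromatic {α : Type*} {X : Set α} {k : ℕ} (c : X → Fin k) (S : Set α) : Prop :=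
  ∃ b : Fin k, ∀ x : X, (x : α) ∈ S → c x = b

end ConstrainedGallai

/-!
A sparse Gallai theorem with polynomial constraints, obtained from a sparse Hales–Jewett theorem by
a generic projection.

*Projection.* Regard `T` as an alphabet and map the cube `T^ι` to `ℝ^d` by `z ↦ ∑ i, c i • z i`
with positive weights `c`. Combinatorial lines go to homothetic copies of `T`. A polynomial that
respects `T` gives, for two distinct points of the cube, a nonzero polynomial in `c`, so generic
weights satisfy all constraints from `F` (`exists_generic_weights`). For generic weights, moreover,
a homothetic copy of `T` in the image comes from a map `T → T^ι` that is homothetic or constant in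
each coordinate. Such coordinates need not be the identity: if `T` is symmetric, they may reverse
it. Hence sparsity is needed for `G`-lines, whose coordinates are constant or belong to a given
set `G` of permutations of `T`, while monochromatic lines are to be found among the combinatorial
lines, which are those with `G = {1}`.

*Sparse Hales–Jewett theorem* (`sparseRamsey`). The absence of short cycles is expressed by
`Sparse`: small subfamilies have leaves. Two combinatorial lines share at most one point, so the
Hales–Jewett theorem itself is the case of sparsity `3`. The partite construction of Nešetřil and
Rödl raises sparsity by one (`SparseRamsey.succ`). It starts from disjoint copies of all
combinatorial lines of a Hales–Jewett cube `Y`, and treats the points `y` of `Y` one at a time: with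
`V` the fibre over `y` of the set `P` constructed so far, take a sparse Ramsey set `W` of words over
the alphabet `V` and attach a copy of `P` along each combinatorial line in `W`. No line of `P` has
two points in `V`, so the new system is sparser than `W` (`Sparse.glue`). Each point keeps its
projection to `Y` as part of its coordinates; this makes every `G`-line of the new set lie in
a single copy of `P` (`exists_copy_of_isGLine`), which uses that the alphabet has at least three
letters. After all points of `Y` have been treated, every colouring contains lifts of all lines of
`Y` coloured according to the projection, and one of them is monochromatic by the choice of `Y`.
-/

namespace ConstrainedGallai

/-! ### Sparse families of sets -/

/-- A family `𝓢` of sets is `g`-sparse if in every subfamily `F` with fewer than `g` members, and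
at least two, for every member `a` (the root) there is another member `b` (a leaf) that has at most
one point in common with the union of the other members of `F`.
This is the absence of cycles shorter than `g`, in a form that is suited to induction. -/
def Sparse {Q : Type*} (g : ℕ) (𝓢 : Set (Set Q)) : Prop :=
  ∀ F : Finset (Set Q), (∀ s ∈ F, s ∈ 𝓢) → F.card < g → ∀ a ∈ F, (∃ b ∈ F, b ≠ a) →
    ∃ b ∈ F, b ≠ a ∧ ∀ x ∈ b, ∀ y ∈ b,
      (∃ c ∈ F, c ≠ b ∧ x ∈ c) → (∃ c ∈ F, c ≠ b ∧ y ∈ c) → x = y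

lemma Sparse.mono {Q : Type*} {g : ℕ} {𝓢 𝓣 : Set (Set Q)} (h : Sparse g 𝓣) (hs : 𝓢 ⊆ 𝓣) :
    Sparse g 𝓢 :=
  fun F hF => h F fun s hsF => hs (hF s hsF)

lemma Sparse.not_isCycle {Q : Type*} {g : ℕ} {𝓢 : Set (Set Q)} (h : Sparse g 𝓢) {ℓ : ℕ}
    (hℓ : ℓ < g) {X : Set Q} {S : Fin ℓ → Set Q} (hS : ∀ i, S i ∈ 𝓢) : ¬ IsCycle X S := by
  classical
  rintro ⟨h2, hinj, -, x, hx, -, hxS⟩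
  obtain ⟨n, rfl⟩ := Nat.exists_eq_add_of_le' h2
  have hrot : ∀ i : Fin (n + 2), finRotate (n + 2) i ≠ i := fun i => by
    have := support_finRotate (n := n)
    have hi : i ∈ (finRotate (n + 2)).support := by rw [this]; exact Finset.mem_univ _
    exact Equiv.Perm.mem_support.1 hi
  obtain ⟨b, hb, -, hleaf⟩ := h (Finset.univ.image S) (by simpa using hS)
    (by rw [Finset.card_image_of_injective _ hinj]; simpa using hℓ) (S 0) (by simp)
    ⟨S (finRotate _ 0), by simp, fun hc => hrot 0 (hinj hc)⟩
  obtain ⟨i, -, rfl⟩ := Finset.mem_image.1 hb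
  -- the two neighbours of `S i` in the cycle meet it in two distinct points
  obtain ⟨j, rfl⟩ := (finRotate (n + 2)).surjective i
  have := hleaf (x (finRotate _ j)) (hxS _).1 (x j) (hxS j).2
    ⟨_, Finset.mem_image_of_mem S (Finset.mem_univ (finRotate _ (finRotate _ j))),
      fun hc => hrot _ (hinj hc), (hxS _).2⟩
    ⟨_, Finset.mem_image_of_mem S (Finset.mem_univ j),
      fun hc => hrot _ (hinj hc).symm, (hxS _).1⟩
  exact hrot j (hx this)

/-- Amalgamation raises sparsity. Glue copies `h L '' P` of a `(g + 1)`-sparse system on `P` along a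
set `V` of which no member of the system contains two points; the way in which the copies of `V`
meet is recorded by the sets `range (m L)`, which are only required to be `g`-sparse. A subfamily
with at most `g` members is easy to treat if it lies in one copy of `P`, or if some copy other than
the root's contains just one member, which is then a leaf. Otherwise it meets fewer than `g` copies;
so there is a leaf among these copies, attached to the rest at one point, and a leaf of the
subfamily is found inside it. -/
lemma Sparse.glue {Q Q' M Λ : Type*} {g : ℕ} {𝓢 : Set (Set Q)} (h𝓢 : Sparse (g + 1) 𝓢)
    {P V : Set Q} (hP : ∀ s ∈ 𝓢, s ⊆ P) (hV : ∀ s ∈ 𝓢, (s ∩ V).Subsingleton)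
    (h : Λ → Q → Q') (hinj : ∀ L, Function.Injective (h L))
    (m : Λ → V → M) (hm : ∀ L, Function.Injective (m L))
    (hU : Function.Injective fun L => Set.range (m L))
    (hUs : Sparse g (Set.range fun L => Set.range (m L)))
    (hmeet : ∀ L L', L ≠ L' → ∀ q ∈ P, ∀ q' ∈ P, h L q = h L' q' →
      ∃ (hq : q ∈ V) (hq' : q' ∈ V), m L ⟨q, hq⟩ = m L' ⟨q', hq'⟩) :
    Sparse (g + 1) {s' | ∃ L, ∃ s ∈ 𝓢, s' = h L '' s} := by
  classical
  intro F hF hcard a ha hab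
  obtain ⟨b₀, hb₀, hb₀a⟩ := hab
  have : Nonempty Λ := ⟨(hF a ha).choose⟩
  choose! l σ hσ𝓢 hσ using hF
  have hout : ∀ b ∈ F, ∀ c ∈ F, l c ≠ l b → ∀ x ∈ b, x ∈ c → ∃ q ∈ σ b, ∃ hq : q ∈ V,
      x = h (l b) q ∧ m (l b) ⟨q, hq⟩ ∈ Set.range (m (l c)) := by
    intro b hb c hc hne x hxb hxc
    rw [hσ b hb] at hxb
    rw [hσ c hc] at hxc
    obtain ⟨q, hq, rfl⟩ := hxb
    obtain ⟨q', hq', he⟩ := hxc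
    obtain ⟨h1, h2, h3⟩ := hmeet _ _ hne.symm q (hP _ (hσ𝓢 b hb) hq) q'
      (hP _ (hσ𝓢 c hc) hq') he.symm
    exact ⟨q, hq, h1, rfl, ⟨_, h3.symm⟩⟩
  have hσinj : ∀ b ∈ F, ∀ c ∈ F, l b = l c → σ b = σ c → b = c := by
    intro b hb c hc h1 h2
    rw [hσ b hb, hσ c hc, h1, h2]
  -- a leaf inside one copy, for a root `r` in this copy
  have hin : ∀ r ∈ F, (∃ b ∈ F, l b = l r ∧ b ≠ r) → ∃ b ∈ F, l b = l r ∧ b ≠ r ∧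
      ∀ x ∈ b, ∀ y ∈ b, (∃ c ∈ F, l c = l r ∧ c ≠ b ∧ x ∈ c) →
        (∃ c ∈ F, l c = l r ∧ c ≠ b ∧ y ∈ c) → x = y := by
    intro r hr ⟨b₁, hb₁, hlb₁, hb₁r⟩
    obtain ⟨s, hs, hsr, hleaf⟩ := h𝓢 ((F.filter fun b => l b = l r).image σ)
      (by
        intro s hs
        obtain ⟨b, hb, rfl⟩ := Finset.mem_image.1 hs
        exact hσ𝓢 b (Finset.mem_filter.1 hb).1)
      ((Finset.card_image_le.trans (Finset.card_filter_le _ _)).trans_lt hcard) (σ r)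
      (Finset.mem_image_of_mem _ (Finset.mem_filter.2 ⟨hr, rfl⟩))
      ⟨σ b₁, Finset.mem_image_of_mem _ (Finset.mem_filter.2 ⟨hb₁, hlb₁⟩),
        fun hc => hb₁r (hσinj _ hb₁ _ hr hlb₁ hc)⟩
    obtain ⟨b, hb, rfl⟩ := Finset.mem_image.1 hs
    obtain ⟨hbF, hlb⟩ := Finset.mem_filter.1 hb
    have key : ∀ q, ∀ c ∈ F, l c = l r → c ≠ b → h (l b) q ∈ c →
        ∃ c ∈ (F.filter fun b => l b = l r).image σ, c ≠ σ b ∧ q ∈ c := by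
      intro q c hc hlc hcb hqc
      refine ⟨σ c, Finset.mem_image_of_mem _ (Finset.mem_filter.2 ⟨hc, hlc⟩),
        fun he => hcb (hσinj _ hc _ hbF (hlc.trans hlb.symm) he), ?_⟩
      rw [hσ c hc, hlc, ← hlb] at hqc
      exact (hinj _).mem_set_image.1 hqc
    refine ⟨b, hbF, hlb, fun hc => hsr (by rw [hc]), fun x hx y hy => ?_⟩
    rintro ⟨c, hc, hlc, hcb, hxc⟩ ⟨c', hc', hlc', hcb', hyc⟩
    have hx' := hx
    have hy' := hy
    rw [hσ b hbF] at hx' hy'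
    obtain ⟨q, hq, rfl⟩ := hx'
    obtain ⟨q', hq', rfl⟩ := hy'
    rw [hleaf q hq q' hq' (key q c hc hlc hcb hxc) (key q' c' hc' hlc' hcb' hyc)]
  by_cases h1 : ∃ b ∈ F, l b ≠ l a ∧ ∀ c ∈ F, c ≠ b → l c ≠ l b
  · obtain ⟨b, hb, hba, hbc⟩ := h1
    refine ⟨b, hb, fun hc => hba (by rw [hc]), fun x hx y hy => ?_⟩
    rintro ⟨c, hc, hcb, hxc⟩ ⟨c', hc', hcb', hyc⟩
    obtain ⟨q, hq, hqV, rfl, -⟩ := hout b hb c hc (hbc c hc hcb) x hx hxc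
    obtain ⟨q', hq', hqV', rfl, -⟩ := hout b hb c' hc' (hbc c' hc' hcb') y hy hyc
    rw [hV _ (hσ𝓢 b hb) ⟨hq, hqV⟩ ⟨hq', hqV'⟩]
  push Not at h1
  by_cases h2 : ∀ b ∈ F, l b = l a
  · obtain ⟨b, hb, -, hba, hleaf⟩ := hin a ha ⟨b₀, hb₀, h2 _ hb₀, hb₀a⟩
    refine ⟨b, hb, hba, fun x hx y hy => ?_⟩
    rintro ⟨c, hc, hcb, hxc⟩ ⟨c', hc', hcb', hyc⟩
    exact hleaf x hx y hy ⟨c, hc, h2 c hc, hcb, hxc⟩ ⟨c', hc', h2 c' hc', hcb', hyc⟩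
  push Not at h2
  obtain ⟨b₁, hb₁, hb₁a⟩ := h2
  -- two members lie in the same copy, so fewer than `g` copies occur
  have hlt : (F.image fun b => Set.range (m (l b))).card < g := by
    obtain ⟨b₂, hb₂, hne, hl⟩ := h1 b₁ hb₁ hb₁a
    have : (F.image fun b => Set.range (m (l b))).card < F.card := by
      refine lt_of_le_of_ne Finset.card_image_le fun he => hne ?_
      exact Finset.card_image_iff.1 he hb₂ hb₁ (by simp [hl])
    omega
  obtain ⟨R, hR, hRa, hleafR⟩ := hUs (F.image fun b => Set.range (m (l b)))
    (by
      intro s hs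
      obtain ⟨b, -, rfl⟩ := Finset.mem_image.1 hs
      exact ⟨_, rfl⟩) hlt (Set.range (m (l a)))
    (Finset.mem_image_of_mem _ ha)
    ⟨_, Finset.mem_image_of_mem _ hb₁, fun hc => hb₁a (hU hc)⟩
  obtain ⟨b₂, hb₂, rfl⟩ := Finset.mem_image.1 hR
  have hb₂a : l b₂ ≠ l a := fun hc => hRa (by rw [hc])
  -- all points that the leaf copy shares with other copies coincide
  have huniq : ∀ b ∈ F, l b = l b₂ → ∀ c ∈ F, l c ≠ l b₂ → ∀ x ∈ b, x ∈ c →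
      ∀ b' ∈ F, l b' = l b₂ → ∀ c' ∈ F, l c' ≠ l b₂ → ∀ x' ∈ b', x' ∈ c' → x = x' := by
    intro b hb hlb c hc hlc x hxb hxc b' hb' hlb' c' hc' hlc' x' hxb' hxc'
    obtain ⟨q, hq, hqV, rfl, hr⟩ := hout b hb c hc (by rwa [hlb]) x hxb hxc
    obtain ⟨q', hq', hqV', rfl, hr'⟩ := hout b' hb' c' hc' (by rwa [hlb']) x' hxb' hxc'
    rw [hlb] at hr
    rw [hlb'] at hr'
    have := hm _ (hleafR _ ⟨_, rfl⟩ _ ⟨_, rfl⟩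
      ⟨_, Finset.mem_image_of_mem _ hc, fun he => hlc (hU he), hr⟩
      ⟨_, Finset.mem_image_of_mem _ hc', fun he => hlc' (hU he), hr'⟩)
    rw [hlb, hlb', Subtype.mk.inj this]
  -- the root of the leaf copy contains this point if any member there does
  obtain ⟨r, hr, hlr, hroot⟩ : ∃ r ∈ F, l r = l b₂ ∧ ∀ b ∈ F, l b = l b₂ → ∀ c ∈ F, l c ≠ l b₂ →
      ∀ x ∈ b, x ∈ c → x ∈ r := by
    by_cases hex : ∃ b ∈ F, l b = l b₂ ∧ ∃ c ∈ F, l c ≠ l b₂ ∧ ∃ x ∈ b, x ∈ c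
    · obtain ⟨r, hr, hlr, c, hc, hlc, x, hxr, hxc⟩ := hex
      refine ⟨r, hr, hlr, fun b hb hlb c' hc' hlc' x' hxb' hxc' => ?_⟩
      rw [huniq b hb hlb c' hc' hlc' x' hxb' hxc' r hr hlr c hc hlc x hxr hxc]
      exact hxr
    · exact ⟨b₂, hb₂, rfl, fun b hb hlb c hc hlc x hxb hxc =>
        absurd ⟨b, hb, hlb, c, hc, hlc, x, hxb, hxc⟩ hex⟩
  obtain ⟨b₃, hb₃, hne, hlb₃⟩ := h1 r hr (by rwa [hlr])
  obtain ⟨b, hb, hlb, hbr, hleaf⟩ := hin r hr ⟨b₃, hb₃, hlb₃, hne⟩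
  have key : ∀ x ∈ b, (∃ c ∈ F, c ≠ b ∧ x ∈ c) → ∃ c ∈ F, l c = l r ∧ c ≠ b ∧ x ∈ c := by
    rintro x hx ⟨c, hc, hcb, hxc⟩
    by_cases hlc : l c = l r
    · exact ⟨c, hc, hlc, hcb, hxc⟩
    · exact ⟨r, hr, rfl, hbr.symm,
        hroot b hb (hlb.trans hlr) c hc (fun h => hlc (h.trans hlr.symm)) x hx hxc⟩
  exact ⟨b, hb, fun hc => hb₂a (by rw [← hlr, ← hlb, hc]), fun x hx y hy hxc hyc =>
    hleaf x hx y hy (key x hx hxc) (key y hy hyc)⟩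

/-! ### Lines in cubes -/

/-- A map `T → T^ι` each of whose coordinates is constant or a permutation that belongs to `G`. -/
def IsGMap {T ι : Type*} (G : Set (Equiv.Perm T)) (e : T → ι → T) : Prop :=
  ∀ i, (∃ σ ∈ G, ∀ t, e t i = σ t) ∨ ∃ a, ∀ t, e t i = a

/-- A parametrized `G`-line of the cube `T^ι`: an injective map `T → T^ι` each of whose coordinates
is constant or a permutation in `G`. For `G = {1}` these are the combinatorial lines of the
Hales–Jewett theorem. -/
def IsGLine {T ι : Type*} (G : Set (Equiv.Perm T)) (e : T → ι → T) : Prop :=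
  IsGMap G e ∧ Function.Injective e

/-- The family of (the point sets of) the `G`-lines contained in `P`. -/
def lineSets {T ι : Type*} (G : Set (Equiv.Perm T)) (P : Set (ι → T)) : Set (Set (ι → T)) :=
  {s | ∃ e, IsGLine G e ∧ (∀ t, e t ∈ P) ∧ s = Set.range e}

section Lines

variable {T ι κ : Type*} {G : Set (Equiv.Perm T)}

lemma exists_ne_ne (hT : 3 ≤ Nat.card T) (a b : T) : ∃ c, c ≠ a ∧ c ≠ b := by
  classical
  by_contra! h
  have hsub : (Set.univ : Set T) ⊆ {a, b} := fun c _ => by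
    by_cases hc : c = a
    · exact Or.inl hc
    · exact Or.inr (h c hc)
  have := (Set.ncard_le_ncard hsub (Set.toFinite _)).trans (Set.ncard_insert_le a {b})
  rw [Set.ncard_univ, Set.ncard_singleton] at this
  omega

lemma IsGMap.injective_or_const {e : T → ι → T} (he : IsGMap G e) :
    Function.Injective e ∨ ∃ z, ∀ t, e t = z := by
  by_cases h : ∃ i, ∃ σ ∈ G, ∀ t, e t i = σ t
  · obtain ⟨i, σ, -, hσ⟩ := h
    exact Or.inl fun s t hst => σ.injective (by rw [← hσ, ← hσ, hst])
  · push Not at h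
    have : ∀ i, ∃ a, ∀ t, e t i = a := fun i => (he i).resolve_left fun ⟨σ, hσ, hc⟩ => by
      obtain ⟨t, ht⟩ := h i σ hσ
      exact ht (hc t)
    choose z hz using this
    exact Or.inr ⟨z, fun t => funext fun i => hz i t⟩

lemma IsGMap.comp_index {e : T → ι → T} (he : IsGMap G e) (ρ : κ → ι) :
    IsGMap G fun t => e t ∘ ρ :=
  fun i => he (ρ i)

lemma IsGMap.eq_of_eq_off_point (hT : 3 ≤ Nat.card T) {e e' : T → ι → T} (he : IsGMap G e)
    (he' : IsGMap G e') (t₀ : T) (h : ∀ t, t ≠ t₀ → e t = e' t) : e = e' := by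
  obtain ⟨t₁, h₁, -⟩ := exists_ne_ne hT t₀ t₀
  obtain ⟨t₂, h₂, h₂₁⟩ := exists_ne_ne hT t₀ t₁
  have perm : ∀ (u v : T → T) (σ : Equiv.Perm T), (∀ t, u t = σ t) → Function.Injective v →
      (∀ t, t ≠ t₀ → u t = v t) → u t₀ = v t₀ := by
    intro u v σ hu hv huv
    obtain ⟨s, hs⟩ := σ.surjective (v t₀)
    by_cases hs₀ : s = t₀
    · rw [hu, ← hs₀, hs, hs₀]
    · exact absurd (hv ((huv s hs₀).symm.trans ((hu s).trans hs))) hs₀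
  refine funext fun t => ?_
  by_cases ht : t = t₀
  · subst ht
    funext i
    have hi : ∀ s, s ≠ t → e s i = e' s i := fun s hs => by rw [h s hs]
    rcases he i with ⟨σ, -, hσ⟩ | ⟨a, ha⟩ <;> rcases he' i with ⟨τ, -, hτ⟩ | ⟨b, hb⟩
    · exact perm (fun t => e t i) (fun t => e' t i) σ hσ
        (fun x y hxy => τ.injective (by rw [← hτ, ← hτ]; exact hxy)) hi
    · exact absurd (σ.injective (by rw [← hσ, ← hσ, hi _ h₂, hi _ h₁, hb, hb])) h₂₁
    · exact absurd (τ.injective (by rw [← hτ, ← hτ, ← hi _ h₂, ← hi _ h₁, ha, ha])) h₂₁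
    · rw [ha, hb, ← ha t₁, hi _ h₁, hb]
  · exact h t ht

lemma IsGMap.id_or_const {e : T → ι → T} (he : IsGMap {1} e) (i : ι) :
    (∀ t, e t i = t) ∨ ∃ a, ∀ t, e t i = a := by
  rcases he i with ⟨σ, rfl, h⟩ | h
  · exact Or.inl h
  · exact Or.inr h

lemma isGMap_one_of_id_or_const {e : T → ι → T}
    (he : ∀ i, (∀ t, e t i = t) ∨ ∃ a, ∀ t, e t i = a) : IsGMap {1} e :=
  fun i => (he i).imp_left fun h => ⟨1, rfl, h⟩

lemma IsGLine.exists_id {e : T → ι → T} (he : IsGLine {1} e) {s t : T} (hst : s ≠ t) :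
    ∃ i, ∀ t, e t i = t := by
  by_contra! h
  refine hst (he.2 (funext fun i => ?_))
  obtain ⟨a, ha⟩ := (he.1.id_or_const i).resolve_left fun hc => by
    obtain ⟨t, ht⟩ := h i
    exact ht (hc t)
  rw [ha, ha]

/-- Two combinatorial lines with two common points are equal. -/
lemma IsGLine.eq_of_two_mem {e e' : T → ι → T} (he : IsGLine {1} e) (he' : IsGLine {1} e')
    {x y : ι → T} (hxy : x ≠ y) (hx : x ∈ Set.range e) (hy : y ∈ Set.range e)
    (hx' : x ∈ Set.range e') (hy' : y ∈ Set.range e') : e = e' := by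
  obtain ⟨s, rfl⟩ := hx
  obtain ⟨t, rfl⟩ := hy
  obtain ⟨s', hs⟩ := hx'
  obtain ⟨t', ht⟩ := hy'
  obtain ⟨i, hi⟩ := Function.ne_iff.1 hxy
  have key : s' = s ∧ t' = t := by
    have hsi := congrFun hs i
    have hti := congrFun ht i
    rcases he.1.id_or_const i with h | ⟨a, h⟩
    · rcases he'.1.id_or_const i with h' | ⟨b, h'⟩
      · rw [h, h'] at hsi hti
        exact ⟨hsi, hti⟩
      · exact absurd (by rw [← hsi, ← hti, h', h']) hi
    · exact absurd (by rw [h, h]) hi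
  obtain ⟨rfl, rfl⟩ := key
  have hne : s' ≠ t' := fun h => hxy (by rw [h])
  funext r j
  have hsj := congrFun hs j
  have htj := congrFun ht j
  rcases he.1.id_or_const j with h | ⟨a, h⟩ <;> rcases he'.1.id_or_const j with h' | ⟨b, h'⟩
  · rw [h, h']
  · exact absurd (by rw [h, h'] at hsj htj; rw [← hsj, ← htj]) hne
  · exact absurd (by rw [h, h'] at hsj htj; rw [hsj, htj]) hne
  · rw [h, h', ← h s', ← hsj, h']

lemma sparse_three_lineSets_one (P : Set (ι → T)) : Sparse 3 (lineSets {1} P) := by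
  classical
  rintro F hF hcard a ha ⟨b, hb, hba⟩
  have hFab : ∀ c ∈ F, c ≠ b → c = a := by
    intro c hc hcb
    by_contra hca
    have : ({a, b, c} : Finset (Set (ι → T))).card ≤ F.card :=
      Finset.card_le_card (by
        intro z hz
        simp only [Finset.mem_insert, Finset.mem_singleton] at hz
        rcases hz with rfl | rfl | rfl <;> assumption)
    rw [Finset.card_eq_three.2 ⟨a, b, c, hba.symm, Ne.symm hca, Ne.symm hcb, rfl⟩] at this
    omega
  refine ⟨b, hb, hba, fun x hx y hy => ?_⟩
  rintro ⟨c, hc, hcb, hxc⟩ ⟨c', hc', hcb', hyc⟩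
  rw [hFab c hc hcb] at hxc
  rw [hFab c' hc' hcb'] at hyc
  obtain ⟨e, he, -, rfl⟩ := hF a ha
  obtain ⟨e', he', -, rfl⟩ := hF b hb
  by_contra hxy
  exact hba (by rw [he.eq_of_two_mem he' hxy hxc hyc hx hy])

lemma hales_jewett (T : Type*) [Finite T] [Nontrivial T] (k : ℕ) :
    ∃ (ι : Type) (_ : Finite ι), ∀ c : (ι → T) → Fin k,
      ∃ e, IsGLine {1} e ∧ ∃ b, ∀ t, c (e t) = b := by
  obtain ⟨ι, hι, h⟩ := Combinatorics.Line.exists_mono_in_high_dimension T (Fin k)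
  refine ⟨ι, inferInstance, fun c => ?_⟩
  obtain ⟨l, b, hb⟩ := h c
  refine ⟨fun t => l t, ⟨isGMap_one_of_id_or_const fun i => ?_, fun s t hst => ?_⟩, b, hb⟩
  · cases hi : l.idxFun i with
    | none => exact Or.inl fun t => l.apply_none t i hi
    | some a => exact Or.inr ⟨a, fun t => l.apply_some hi⟩
  · obtain ⟨i, hi⟩ := l.proper
    have := congrFun hst i
    exact (l.apply_none s i hi).symm.trans (this.trans (l.apply_none t i hi))

end Lines

/-- There is a finite cube `T^ι` with a subset `W` whose `G`-lines form a `g`-sparse family, and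
such that every `k`-colouring has a monochromatic combinatorial line in `W`. -/
def SparseRamsey (T : Type) (G : Set (Equiv.Perm T)) (g k : ℕ) : Prop :=
  ∃ (ι : Type) (_ : Finite ι) (W : Set (ι → T)), Sparse g (lineSets G W) ∧
    ∀ c : (ι → T) → Fin k, ∃ e, IsGLine {1} e ∧ (∀ t, e t ∈ W) ∧ ∃ b, ∀ t, c (e t) = b

lemma sparseRamsey_three (T : Type) [Finite T] [Nontrivial T] (k : ℕ) :
    SparseRamsey T {1} 3 k := by
  obtain ⟨ι, hι, h⟩ := hales_jewett T k
  refine ⟨ι, hι, Set.univ, sparse_three_lineSets_one _, fun c => ?_⟩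
  obtain ⟨e, he, hb⟩ := h c
  exact ⟨e, he, fun _ => trivial, hb⟩

/-! ### The partite construction -/

/-- A stage of the partite construction over the cube `Y = T^η`. It is a set `P` of points of
`T^ι`; the coordinates selected by `ρ` project it to `Y`. The set `D ⊆ Y` consists of the points
whose fibres have been treated: every colouring of `P` has lifts of all combinatorial lines of `Y`
on which the colour of a point over `D` depends only on its projection. The fibres have at
least three points, so that they can serve as alphabets in turn. -/
structure Stage {T η ι : Type} (G : Set (Equiv.Perm T)) (g k : ℕ) (ρ : η → ι) (P : Set (ι → T))
    (D : Finset (η → T)) : Prop where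
  sparse : Sparse g (lineSets G P)
  proj_injective : ∀ e, IsGLine G e → (∀ t, e t ∈ P) → Function.Injective fun t => e t ∘ ρ
  fibre : ∀ y : η → T, ∃ j : Fin 3 → ι → T, Function.Injective j ∧
    ∀ i, j i ∈ P ∧ j i ∘ ρ = y
  ramsey : ∀ c : (ι → T) → Fin k, ∃ χ : (η → T) → Fin k, ∀ l : T → η → T, IsGLine {1} l →
    ∃ e, IsGLine {1} e ∧ (∀ t, e t ∈ P) ∧ (∀ t, e t ∘ ρ = l t) ∧ ∀ t, l t ∈ D → c (e t) = χ (l t)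

section Start

variable {T η : Type} {G : Set (Equiv.Perm T)}

/-- The construction starts from three disjoint copies of each combinatorial line of `Y`. They are
told apart by additional coordinates that take only two values, so that no `G`-line can move in
these coordinates. -/
lemma exists_stage_empty [Finite T] [Finite η] [Nonempty η] (hT : 3 ≤ Nat.card T) (g k : ℕ)
    (hk : 0 < k) :
    ∃ (ι : Type) (_ : Finite ι) (ρ : η → ι) (P : Set (ι → T)), Stage G g k ρ P ∅ := by
  classical
  have : Nontrivial T := Finite.one_lt_card_iff_nontrivial.1 (by omega)
  obtain ⟨t₀, t₁, h01⟩ := exists_pair_ne T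
  let A : Type := {l : T → η → T // IsGLine {1} l} × Fin 3
  let code : A → A → T := fun a b => if b = a then t₁ else t₀
  have hcode : Function.Injective code := by
    intro a b hab
    by_contra hne
    have := congrFun hab a
    simp [code, hne, h01.symm] at this
  let pt : A → T → η ⊕ A → T := fun a t => Sum.elim (a.1.1 t) (code a)
  let P : Set (η ⊕ A → T) := {z | ∃ a t, z = pt a t}
  have hlift : ∀ a : A, IsGLine {1} (pt a) := fun a =>
    ⟨fun i => by
      cases i with
      | inl i => exact a.1.2.1 i
      | inr b => exact Or.inr ⟨code a b, fun t => rfl⟩,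
     fun s t hst => a.1.2.2 (funext fun i => congrFun hst (Sum.inl i))⟩
  -- a `G`-line of `P` is a reparametrization of one of the copies
  have hedge : ∀ e, IsGLine G e → (∀ t, e t ∈ P) → ∃ a : A, ∃ τ : T → T,
      Function.Injective τ ∧ ∀ t, e t = pt a (τ t) := by
    intro e he heP
    choose a τ haτ using heP
    have hconst : ∀ t, a t = a t₀ := fun t => by
      apply hcode
      funext b
      rcases he.1 (Sum.inr b) with ⟨σ, -, hσ⟩ | ⟨z, hz⟩
      · obtain ⟨t₂, h₂, h₂'⟩ := exists_ne_ne hT t₀ t₁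
        obtain ⟨s, hs⟩ := σ.surjective t₂
        have h3 : code (a s) b = t₂ := by
          rw [← hs, ← hσ, haτ s]
          rfl
        simp only [code] at h3
        split_ifs at h3
        · exact absurd h3.symm h₂'
        · exact absurd h3.symm h₂
      · have h3 : ∀ t, code (a t) b = z := fun t => by
          rw [← hz t, haτ t]
          rfl
        rw [h3, h3]
    refine ⟨a t₀, τ, fun s t hst => he.2 ?_, fun t => by rw [haτ t, hconst t]⟩
    rw [haτ s, haτ t, hconst s, hconst t, hst]
  refine ⟨η ⊕ A, inferInstance, Sum.inl, P, ?_, ?_, ?_, ?_⟩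
  · have hset : ∀ s ∈ lineSets G P, ∃ a, s = Set.range (pt a) := by
      rintro s ⟨e, he, heP, rfl⟩
      obtain ⟨a, τ, hτ, heτ⟩ := hedge e he heP
      refine ⟨a, ?_⟩
      rw [funext heτ]
      exact (Finite.surjective_of_injective hτ).range_comp (pt a)
    rintro F hF - a ha ⟨b, hb, hba⟩
    refine ⟨b, hb, hba, fun x hx y hy => ?_⟩
    rintro ⟨c, hc, hcb, hxc⟩ -
    obtain ⟨i, rfl⟩ := hset b (hF b hb)
    obtain ⟨j, rfl⟩ := hset c (hF c hc)
    obtain ⟨s, rfl⟩ := hx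
    obtain ⟨t, ht⟩ := hxc
    have : j = i := hcode (funext fun b => congrFun ht (Sum.inr b))
    exact absurd (by rw [this]) hcb
  · intro e he heP s t hst
    obtain ⟨a, τ, hτ, heτ⟩ := hedge e he heP
    refine hτ (a.1.2.2 ?_)
    funext i
    have := congrFun hst i
    simpa [heτ, pt] using this
  · intro y
    let i₀ : η := Classical.arbitrary η
    let l : T → η → T := fun t => Function.update y i₀ t
    have hl : IsGLine {1} l := by
      refine ⟨isGMap_one_of_id_or_const fun i => ?_, fun s t hst => ?_⟩
      · by_cases hi : i = i₀
        · subst hi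
          exact Or.inl fun t => by simp [l]
        · exact Or.inr ⟨y i, fun t => by simp [l, hi]⟩
      · have := congrFun hst i₀
        simpa [l] using this
    refine ⟨fun j => pt (⟨l, hl⟩, j) (y i₀), fun i j hij => ?_, fun j => ⟨⟨_, _, rfl⟩, ?_⟩⟩
    · have : ((⟨l, hl⟩, i) : A) = (⟨l, hl⟩, j) :=
        hcode (funext fun b => congrFun hij (Sum.inr b))
      exact (Prod.ext_iff.1 this).2
    · funext i
      simp [pt, l]
  · intro c
    exact ⟨fun _ => ⟨0, hk⟩, fun l hl => ⟨pt (⟨l, hl⟩, 0), hlift _, fun t => ⟨_, _, rfl⟩,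
      fun t => rfl, fun t ht => absurd ht (Finset.notMem_empty _)⟩⟩

end Start

section Step

variable {T η ι κ : Type} {G : Set (Equiv.Perm T)}

open Classical in
/-- The extension of a combinatorial line `L` over the alphabet `V ⊆ Z` to letters `q ∈ Z`: put `q`
in the active coordinates of `L` and leave the constant coordinates, which are letters in `V`. The
letter `v₀` serves only to read off these constants. -/
noncomputable def extendLine {Z : Type*} {V : Set Z} (v₀ : V) (L : V → κ → V) (q : Z) (j : κ) : Z :=
  if ∀ v, L v j = v then q else L v₀ j

/-- The point over `q` in the copy of the previous stage that is attached along the line `L`. Its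
first block of coordinates is the projection of `q`. -/
noncomputable def copyPoint (ρ : η → ι) {V : Set (ι → T)} (v₀ : V) (L : V → κ → V) (q : ι → T) :
    η ⊕ κ × ι → T :=
  Sum.elim (q ∘ ρ) fun p => extendLine v₀ L q p.1 p.2

lemma extendLine_of_active {Z : Type*} {V : Set Z} (v₀ : V) {L : V → κ → V} {j : κ}
    (h : ∀ v, L v j = v) (q : Z) : extendLine v₀ L q j = q :=
  if_pos h

lemma extendLine_of_not_active {Z : Type*} {V : Set Z} (v₀ : V) {L : V → κ → V} {j : κ}
    (h : ¬ ∀ v, L v j = v) (q : Z) : extendLine v₀ L q j = L v₀ j :=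
  if_neg h

lemma extendLine_coe {Z : Type*} {V : Set Z} (v₀ : V) {L : V → κ → V} (hL : IsGLine {1} L)
    (q : V) : extendLine v₀ L (q : Z) = fun j => (L q j : Z) := by
  funext j
  by_cases h : ∀ v, L v j = v
  · rw [extendLine_of_active v₀ h, h]
  · obtain ⟨a, ha⟩ := (hL.1.id_or_const j).resolve_left h
    rw [extendLine_of_not_active v₀ h, ha, ha]

lemma copyPoint_block {ρ : η → ι} {V : Set (ι → T)} (v₀ : V) (L : V → κ → V) (q : ι → T) (j : κ) :
    (fun i => copyPoint ρ v₀ L q (Sum.inr (j, i))) = extendLine v₀ L q j :=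
  rfl

lemma copyPoint_injective {ρ : η → ι} {V : Set (ι → T)} (hV : V.Nontrivial)
    (v₀ : V) {L : V → κ → V} (hL : IsGLine {1} L) : Function.Injective (copyPoint ρ v₀ L) := by
  intro q q' h
  obtain ⟨x, hx, y, hy, hxy⟩ := hV
  obtain ⟨j, hj⟩ := hL.exists_id (s := ⟨x, hx⟩) (t := ⟨y, hy⟩) (fun h => hxy (Subtype.mk.inj h))
  have := congrArg (fun z i => z (Sum.inr (j, i))) h
  simpa only [copyPoint_block, extendLine_of_active v₀ hj] using this

/-- The next stage: all copies of `P` attached along the combinatorial lines contained in `W`. -/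
def amalgam (ρ : η → ι) (P : Set (ι → T)) {V : Set (ι → T)} (v₀ : V) (W : Set (κ → V)) :
    Set (η ⊕ κ × ι → T) :=
  {z | ∃ L, IsGLine {1} L ∧ (∀ v, L v ∈ W) ∧ ∃ q ∈ P, z = copyPoint ρ v₀ L q}

/-- Two distinct copies of `P` meet only in points of the glued fibre `V`. Away from `V`, a point
of a copy determines the active coordinates of its line, namely those that hold a letter outside
`V`, and hence the line. -/
lemma copyPoint_eq_copyPoint {ρ : η → ι} {P : Set (ι → T)} {y : η → T}
    {V : Set (ι → T)} (hV : V = {z | z ∈ P ∧ z ∘ ρ = y}) (v₀ : V) {L L' : V → κ → V}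
    (hL : IsGLine {1} L) (hL' : IsGLine {1} L') (hne : L ≠ L') {q q' : ι → T} (hq : q ∈ P)
    (hq' : q' ∈ P) (h : copyPoint ρ v₀ L q = copyPoint ρ v₀ L' q') :
    ∃ (h₁ : q ∈ V) (h₂ : q' ∈ V), L ⟨q, h₁⟩ = L' ⟨q', h₂⟩ := by
  have hπ : q ∘ ρ = q' ∘ ρ := funext fun i => congrFun h (Sum.inl i)
  have hblock : ∀ j, extendLine v₀ L q j = extendLine v₀ L' q' j := fun j =>
    funext fun i => congrFun h (Sum.inr (j, i))
  by_cases hy : q ∘ ρ = y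
  · have h₁ : q ∈ V := by rw [hV]; exact ⟨hq, hy⟩
    have h₂ : q' ∈ V := by rw [hV]; exact ⟨hq', hπ ▸ hy⟩
    refine ⟨h₁, h₂, funext fun j => Subtype.ext ?_⟩
    have := hblock j
    rwa [extendLine_coe v₀ hL ⟨q, h₁⟩, extendLine_coe v₀ hL' ⟨q', h₂⟩] at this
  · have h₁ : q ∉ V := by rw [hV]; exact fun hc => hy hc.2
    have h₂ : q' ∉ V := by rw [hV]; exact fun hc => hy (hπ.trans hc.2)
    refine absurd (funext fun v => funext fun j => ?_) hne
    have hj := hblock j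
    by_cases ha : ∀ v, L v j = v <;> by_cases ha' : ∀ v, L' v j = v
    · rw [ha, ha']
    · rw [extendLine_of_active v₀ ha, extendLine_of_not_active v₀ ha'] at hj
      exact absurd (hj ▸ (L' v₀ j).2) h₁
    · rw [extendLine_of_not_active v₀ ha, extendLine_of_active v₀ ha'] at hj
      exact absurd (hj ▸ (L v₀ j).2) h₂
    · rw [extendLine_of_not_active v₀ ha, extendLine_of_not_active v₀ ha'] at hj
      obtain ⟨a, haa⟩ := (hL.1.id_or_const j).resolve_left ha
      obtain ⟨b, hbb⟩ := (hL'.1.id_or_const j).resolve_left ha'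
      rw [haa v, hbb v, ← haa v₀, ← hbb v₀]
      exact Subtype.ext hj

/-- Every `G`-line of the amalgam lies in a single copy. Its blocks of coordinates are constant or
`G`-lines of `P`, and each point of a block lies over the projection of the line or over `y`. As the
alphabet has at least three letters, this forces all moving blocks to have the same projection as
the line, and then to be equal. -/
lemma exists_copy_of_isGLine {g k : ℕ} {ρ : η → ι} {P : Set (ι → T)} {D : Finset (η → T)}
    (hT : 3 ≤ Nat.card T) (hS : Stage G g k ρ P D) {y : η → T}
    {V : Set (ι → T)} (hV : V = {z | z ∈ P ∧ z ∘ ρ = y}) (v₀ : V) {W : Set (κ → V)}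
    {e : T → η ⊕ κ × ι → T} (he : IsGLine G e) (heP : ∀ t, e t ∈ amalgam ρ P v₀ W) :
    ∃ L, IsGLine {1} L ∧ (∀ v, L v ∈ W) ∧ ∃ φ, IsGLine G φ ∧ (∀ t, φ t ∈ P) ∧
      ∀ t, e t = copyPoint ρ v₀ L (φ t) := by
  have hVmem : ∀ z, z ∈ V ↔ z ∈ P ∧ z ∘ ρ = y := fun z => by rw [hV]; rfl
  choose L hL hLW q hq heq using heP
  let f : T → η → T := fun t i => e t (Sum.inl i)
  let φ : κ → T → ι → T := fun j t i => e t (Sum.inr (j, i))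
  have hf : ∀ t, f t = q t ∘ ρ := fun t => by
    funext i
    simp only [f, heq t]
    rfl
  have hφ : ∀ j t, φ j t = extendLine v₀ (L t) (q t) j := fun j t => by
    funext i
    simp only [φ]
    rw [heq t]
    rfl
  have hfG : IsGMap G f := he.1.comp_index Sum.inl
  have hφG : ∀ j, IsGMap G (φ j) := fun j => he.1.comp_index fun i => Sum.inr (j, i)
  have hφq : ∀ j t, φ j t = q t ∨ φ j t ∈ V := fun j t => by
    rw [hφ]
    by_cases h : ∀ v, L t v j = v
    · exact Or.inl (extendLine_of_active v₀ h _)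
    · rw [extendLine_of_not_active v₀ h]
      exact Or.inr (L t v₀ j).2
  have hφP : ∀ j t, φ j t ∈ P := fun j t => by
    rcases hφq j t with h | h
    · rw [h]; exact hq t
    · exact ((hVmem _).1 h).1
  have hφπ : ∀ j t, φ j t ∘ ρ = f t ∨ φ j t ∘ ρ = y := fun j t => by
    rcases hφq j t with h | h
    · exact Or.inl (by rw [h, hf])
    · exact Or.inr ((hVmem _).1 h).2
  have hproj : ∀ j, Function.Injective (φ j) → Function.Injective fun t => φ j t ∘ ρ :=
    fun j hj => hS.proj_injective _ ⟨hφG j, hj⟩ (hφP j)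
  have hT' : Nontrivial T := by
    have : Finite T := Nat.finite_of_card_ne_zero (by omega)
    exact Finite.one_lt_card_iff_nontrivial.1 (by omega)
  obtain ⟨s₀, s₁, h01⟩ := exists_pair_ne T
  have hfinj : Function.Injective f := by
    refine hfG.injective_or_const.resolve_right fun ⟨u, hu⟩ => ?_
    have : ∃ j, Function.Injective (φ j) := by
      by_contra! hc
      have hc' : ∀ j, ∃ z, ∀ t, φ j t = z := fun j => (hφG j).injective_or_const.resolve_left (hc j)
      refine h01 (he.2 (funext fun i => ?_))
      rcases i with i | ⟨j, i⟩
      · exact congrFun ((hu s₀).trans (hu s₁).symm) i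
      · obtain ⟨z, hz⟩ := hc' j
        exact congrFun ((hz s₀).trans (hz s₁).symm) i
    obtain ⟨j, hj⟩ := this
    -- three points of an injective map cannot share two values
    obtain ⟨s₂, h20, h21⟩ := exists_ne_ne hT s₀ s₁
    have key := hproj j hj
    have h3 : ∀ t, φ j t ∘ ρ = u ∨ φ j t ∘ ρ = y := fun t => hu t ▸ hφπ j t
    rcases h3 s₀ with a | a <;> rcases h3 s₁ with b | b <;> rcases h3 s₂ with c | c
    · exact h01 (key (a.trans b.symm))
    · exact h01 (key (a.trans b.symm))
    · exact h20 (key (c.trans a.symm))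
    · exact h21 (key (c.trans b.symm))
    · exact h21 (key (c.trans b.symm))
    · exact h20 (key (c.trans a.symm))
    · exact h01 (key (a.trans b.symm))
    · exact h01 (key (a.trans b.symm))
  have hconst : ∀ j z, (∀ t, φ j t = z) → z ∈ V := fun j z hz => by
    refine (hVmem z).2 ⟨hz s₀ ▸ hφP j s₀, ?_⟩
    by_contra hzy
    have : ∀ t, f t = z ∘ ρ := fun t => by
      have h := hφπ j t
      rw [hz t] at h
      exact (h.resolve_right hzy).symm
    exact h01 (hfinj ((this s₀).trans (this s₁).symm))
  have hπf : ∀ j, Function.Injective (φ j) → (fun t => φ j t ∘ ρ) = f := fun j hj => by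
    have hG : IsGMap G fun t => φ j t ∘ ρ := (hφG j).comp_index ρ
    by_cases hex : ∃ t₀, φ j t₀ ∘ ρ = y
    · obtain ⟨t₀, ht₀⟩ := hex
      exact hG.eq_of_eq_off_point hT hfG t₀ fun t ht =>
        (hφπ j t).resolve_right fun hc => ht (hproj j hj (hc.trans ht₀.symm))
    · exact funext fun t => (hφπ j t).resolve_right fun hc => hex ⟨t, hc⟩
  have hq_of : ∀ j, Function.Injective (φ j) → ∀ t, f t ≠ y → φ j t = q t := fun j hj t ht =>
    (hφq j t).resolve_right fun hc => ht (by
      rw [← hπf j hj]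
      exact ((hVmem _).1 hc).2)
  have hsame : ∀ j j', Function.Injective (φ j) → Function.Injective (φ j') → φ j = φ j' := by
    intro j j' hj hj'
    by_cases hex : ∃ t₀, f t₀ = y
    · obtain ⟨t₀, ht₀⟩ := hex
      refine (hφG j).eq_of_eq_off_point hT (hφG j') t₀ fun t ht => ?_
      have : f t ≠ y := fun hc => ht (hfinj (hc.trans ht₀.symm))
      rw [hq_of j hj t this, hq_of j' hj' t this]
    · refine funext fun t => ?_
      have : f t ≠ y := fun hc => hex ⟨t, hc⟩
      rw [hq_of j hj t this, hq_of j' hj' t this]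
  obtain ⟨t₁, ht₁⟩ : ∃ t₁, f t₁ ≠ y := by
    by_contra! hc
    exact h01 (hfinj ((hc s₀).trans (hc s₁).symm))
  have hqV : q t₁ ∉ V := fun hc => ht₁ (by rw [hf]; exact ((hVmem _).1 hc).2)
  have hactive : ∀ j, (∀ v, L t₁ v j = v) → Function.Injective (φ j) := fun j hj => by
    refine (hφG j).injective_or_const.resolve_right fun ⟨z, hz⟩ => hqV ?_
    have := hφ j t₁
    rw [extendLine_of_active v₀ hj] at this
    rw [← this, hz]
    exact hconst j z hz
  -- the line of any point of `e` outside the glued fibre will do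
  obtain ⟨j, hj⟩ : ∃ j, ∀ v, L t₁ v j = v := by
    obtain ⟨w, hwi, hw⟩ := hS.fibre y
    exact (hL t₁).exists_id (s := ⟨w 0, (hVmem _).2 (hw 0)⟩) (t := ⟨w 1, (hVmem _).2 (hw 1)⟩)
      fun h => absurd (hwi (Subtype.mk.inj h)) (by decide)
  have hjinj := hactive j hj
  refine ⟨L t₁, hL t₁, hLW t₁, φ j, ⟨hφG j, hjinj⟩, hφP j, fun t => ?_⟩
  funext i
  rcases i with i | ⟨j', i⟩
  · exact congrFun (congrFun (hπf j hjinj).symm t) i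
  · change φ j' t i = extendLine v₀ (L t₁) (φ j t) j' i
    refine congrFun ?_ i
    by_cases hj' : ∀ v, L t₁ v j' = v
    · rw [extendLine_of_active v₀ hj', hsame j' j (hactive j' hj') hjinj]
    · rw [extendLine_of_not_active v₀ hj']
      have h1 := hφ j' t₁
      rw [extendLine_of_not_active v₀ hj'] at h1
      rcases (hφG j').injective_or_const with hi | ⟨z, hz⟩
      · refine absurd ?_ ht₁
        have h2 := (hVmem _).1 (L t₁ v₀ j').2
        rw [← h1] at h2
        rw [← hπf j' hi]
        exact h2.2
      · rw [hz t, ← hz t₁, h1]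

lemma Stage.exists_insert [Finite T] [Finite η] [Finite ι] {g k : ℕ} (hT : 3 ≤ Nat.card T)
    {ρ : η → ι} {P : Set (ι → T)} {D : Finset (η → T)} (hk : 0 < k)
    (hS : Stage G (g + 1) k ρ P D)
    (hV : ∀ V : Type, [Finite V] → 3 ≤ Nat.card V → SparseRamsey V {1} g k)
    (y : η → T) [DecidableEq (η → T)] :
    ∃ (ι' : Type) (_ : Finite ι') (ρ' : η → ι') (P' : Set (ι' → T)),
      Stage G (g + 1) k ρ' P' (insert y D) := by
  obtain ⟨w, hwi, hw⟩ := hS.fibre y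
  obtain ⟨V, hVdef⟩ : ∃ V : Set (ι → T), V = {z | z ∈ P ∧ z ∘ ρ = y} := ⟨_, rfl⟩
  have hVmem : ∀ z, z ∈ V ↔ z ∈ P ∧ z ∘ ρ = y := fun z => by rw [hVdef]; rfl
  have hw' : ∀ i, w i ∈ V := fun i => (hVmem _).2 (hw i)
  have hVcard : 3 ≤ Nat.card V := by
    have := Nat.card_le_card_of_injective (fun i => (⟨w i, hw' i⟩ : V))
      fun i j hij => hwi (Subtype.mk.inj hij)
    simpa using this
  have hVnt : V.Nontrivial := ⟨w 0, hw' 0, w 1, hw' 1, fun h => absurd (hwi h) (by decide)⟩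
  let v₀ : V := ⟨w 0, hw' 0⟩
  obtain ⟨κ, hκ, W, hWs, hWr⟩ := hV V hVcard
  have hlinj : Function.Injective fun L : {L : V → κ → V // IsGLine {1} L ∧ ∀ v, L v ∈ W} =>
      Set.range L.1 := by
    rintro ⟨L, hL⟩ ⟨L', hL'⟩ h
    have h' : Set.range L = Set.range L' := h
    refine Subtype.ext (hL.1.eq_of_two_mem hL'.1 (x := L ⟨w 0, hw' 0⟩) (y := L ⟨w 1, hw' 1⟩)
      (fun he => ?_) ⟨_, rfl⟩ ⟨_, rfl⟩ (h' ▸ ⟨_, rfl⟩) (h' ▸ ⟨_, rfl⟩))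
    exact absurd (hwi (Subtype.mk.inj (hL.1.2 he))) (by decide)
  refine ⟨η ⊕ κ × ι, inferInstance, Sum.inl, amalgam ρ P v₀ W, ?_, ?_, ?_, ?_⟩
  · refine (Sparse.glue hS.sparse (P := P) (V := V) ?_ ?_
      (Λ := {L : V → κ → V // IsGLine {1} L ∧ ∀ v, L v ∈ W}) (fun L => copyPoint ρ v₀ L.1)
      (fun L => copyPoint_injective hVnt v₀ L.2.1) (fun L => L.1) (fun L => L.2.1.2) hlinj
      (hWs.mono ?_) ?_).mono ?_
    · rintro s ⟨e, -, heP, rfl⟩ _ ⟨t, rfl⟩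
      exact heP t
    · rintro s ⟨e, he, heP, rfl⟩ _ ⟨⟨t, rfl⟩, ht⟩ _ ⟨⟨t', rfl⟩, ht'⟩
      rw [hS.proj_injective e he heP (((hVmem _).1 ht).2.trans ((hVmem _).1 ht').2.symm)]
    · rintro _ ⟨L, rfl⟩
      exact ⟨L.1, L.2.1, L.2.2, rfl⟩
    · intro L L' hne q hq q' hq' h
      exact copyPoint_eq_copyPoint hVdef v₀ L.2.1 L'.2.1 (fun h => hne (Subtype.ext h)) hq hq' h
    · rintro s ⟨e, he, heP, rfl⟩
      obtain ⟨L, hL, hLW, φ, hφ, hφP, heφ⟩ := exists_copy_of_isGLine hT hS hVdef v₀ he heP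
      refine ⟨⟨L, hL, hLW⟩, Set.range φ, ⟨φ, hφ, hφP, rfl⟩, ?_⟩
      rw [← Set.range_comp]
      exact congrArg _ (funext heφ)
  · intro e he heP
    obtain ⟨L, hL, hLW, φ, hφ, hφP, heφ⟩ := exists_copy_of_isGLine hT hS hVdef v₀ he heP
    intro s t hst
    refine hS.proj_injective φ hφ hφP ?_
    funext i
    have := congrFun hst i
    simpa [heφ, copyPoint] using this
  · intro u
    obtain ⟨L, hL, hLW, -⟩ := hWr fun _ => ⟨0, hk⟩
    obtain ⟨j, hj, hjP⟩ := hS.fibre u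
    exact ⟨fun i => copyPoint ρ v₀ L (j i), (copyPoint_injective hVnt v₀ hL).comp hj,
      fun i => ⟨⟨L, hL, hLW, j i, (hjP i).1, rfl⟩, (hjP i).2⟩⟩
  · intro c
    -- a line of `W` on which the points over `y` get one colour `b`
    obtain ⟨L, hL, hLW, b, hb⟩ := hWr fun x => c (Sum.elim y fun p => (x p.1 : ι → T) p.2)
    have hb' : ∀ q ∈ V, c (copyPoint ρ v₀ L q) = b := by
      intro q hq
      rw [← hb ⟨q, hq⟩, copyPoint, ((hVmem q).1 hq).2, extendLine_coe v₀ hL ⟨q, hq⟩]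
    obtain ⟨χ, hχ⟩ := hS.ramsey fun q => c (copyPoint ρ v₀ L q)
    refine ⟨Function.update χ y b, fun l hl => ?_⟩
    obtain ⟨e, he, heP, hel, hec⟩ := hχ l hl
    refine ⟨fun t => copyPoint ρ v₀ L (e t), ⟨fun i => ?_, ?_⟩,
      fun t => ⟨L, hL, hLW, e t, heP t, rfl⟩, hel, fun t ht => ?_⟩
    · rcases i with i | ⟨j, i⟩
      · exact he.1 (ρ i)
      · by_cases h : ∀ v, L v j = v
        · simpa only [copyPoint, Sum.elim_inr, extendLine_of_active v₀ h] using he.1 i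
        · refine Or.inr ⟨(L v₀ j : ι → T) i, fun t => ?_⟩
          simp only [copyPoint, Sum.elim_inr, extendLine_of_not_active v₀ h]
    · exact (copyPoint_injective hVnt v₀ hL).comp he.2
    · by_cases hy : l t = y
      · rw [hy, Function.update_self]
        exact hb' _ ((hVmem _).2 ⟨heP t, (hel t).trans hy⟩)
      · rw [Function.update_of_ne hy]
        exact hec t ((Finset.mem_insert.1 ht).resolve_left hy)

end Step

/-- One run of the partite construction: combinatorial lines of sparsity `g` over all alphabets give
`G`-lines of sparsity `g + 1`. -/
lemma SparseRamsey.succ {g k : ℕ} (hk : 0 < k)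
    (hV : ∀ V : Type, [Finite V] → 3 ≤ Nat.card V → SparseRamsey V {1} g k)
    (T : Type) [Finite T] (hT : 3 ≤ Nat.card T) (G : Set (Equiv.Perm T)) :
    SparseRamsey T G (g + 1) k := by
  classical
  have hT' : Nontrivial T := Finite.one_lt_card_iff_nontrivial.1 (by omega)
  obtain ⟨η, hη, hHJ⟩ := hales_jewett T k
  have hne : Nonempty η := by
    obtain ⟨e, he, -⟩ := hHJ fun _ => ⟨0, hk⟩
    obtain ⟨s, t, hst⟩ := exists_pair_ne T
    obtain ⟨i, -⟩ := he.exists_id hst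
    exact ⟨i⟩
  have := Fintype.ofFinite (η → T)
  have hstage : ∀ D : Finset (η → T), ∃ (ι : Type) (_ : Finite ι) (ρ : η → ι) (P : Set (ι → T)),
      Stage G (g + 1) k ρ P D := by
    intro D
    induction D using Finset.induction_on with
    | empty => exact exists_stage_empty hT (g + 1) k hk
    | insert y D _ ih =>
      obtain ⟨ι, hι, ρ, P, hS⟩ := ih
      exact hS.exists_insert hT hk hV y
  obtain ⟨ι, hι, ρ, P, hS⟩ := hstage Finset.univ
  refine ⟨ι, hι, P, hS.sparse, fun c => ?_⟩
  obtain ⟨χ, hχ⟩ := hS.ramsey c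
  obtain ⟨l, hl, b, hb⟩ := hHJ χ
  obtain ⟨e, he, heP, -, hec⟩ := hχ l hl
  exact ⟨e, he, heP, b, fun t => (hec t (Finset.mem_univ _)).trans (hb t)⟩

/-- The sparse Hales–Jewett theorem, for `G`-lines. -/
theorem sparseRamsey {k : ℕ} (hk : 0 < k) (g : ℕ) (T : Type) [Finite T] (hT : 3 ≤ Nat.card T)
    (G : Set (Equiv.Perm T)) : SparseRamsey T G (g + 4) k := by
  induction g generalizing T with
  | zero =>
    refine SparseRamsey.succ hk (fun V _ hVc => ?_) T hT G
    have : Nontrivial V := Finite.one_lt_card_iff_nontrivial.1 (by omega)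
    exact sparseRamsey_three V k
  | succ g ih => exact SparseRamsey.succ hk (fun V _ hVc => ih V hVc {1}) T hT G

/-! ### Generic projections -/

/-- Countably many nonzero polynomials have a common non-zero with positive coordinates, by Baire's
theorem. -/
lemma exists_pos_forall_eval_ne_zero {ι : Type*} [Finite ι] (Φ : Set (MvPolynomial ι ℝ))
    (hc : Φ.Countable) (h0 : ∀ p ∈ Φ, p ≠ 0) :
    ∃ c : ι → ℝ, (∀ i, 0 < c i) ∧ ∀ p ∈ Φ, MvPolynomial.eval c p ≠ 0 := by
  have := Fintype.ofFinite ι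
  have hdense : Dense (⋂ p ∈ Φ, {c : ι → ℝ | MvPolynomial.eval c p ≠ 0}) := by
    refine dense_biInter_of_isOpen (fun p _ => ?_) hc fun p hp => ?_
    · exact isOpen_ne_fun (MvPolynomial.continuous_eval p) continuous_const
    · rw [Metric.dense_iff]
      intro x r hr
      by_contra hne
      rw [Set.not_nonempty_iff_eq_empty] at hne
      refine h0 p hp (MvPolynomial.funext_set (fun i => Metric.ball (x i) r) (fun i => ?_)
        fun z hz => ?_)
      · rw [Real.ball_eq_Ioo]
        exact Set.Ioo_infinite (by linarith)
      · rw [map_zero]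
        by_contra hz0
        have : z ∈ Metric.ball x r ∩ {c : ι → ℝ | MvPolynomial.eval c p ≠ 0} :=
          ⟨by rw [ball_pi x hr]; exact hz, hz0⟩
        rw [hne] at this
        exact this
  have hopen : IsOpen (Set.univ.pi fun _ : ι => Set.Ioi (0 : ℝ)) :=
    isOpen_set_pi Set.finite_univ fun _ _ => isOpen_Ioi
  obtain ⟨c, hcpos, hc⟩ := hdense.inter_open_nonempty _ hopen ⟨fun _ => 1, fun _ _ => by simp⟩
  exact ⟨c, fun i => hcpos i trivial, fun p hp => Set.mem_iInter₂.1 hc p hp⟩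

/-- The polynomial, in the weights `c`, whose value is the linear form `∑ i, c i * a i`. -/
noncomputable def linearForm {ι : Type*} [Fintype ι] (a : ι → ℝ) : MvPolynomial ι ℝ :=
  ∑ i, MvPolynomial.X i * MvPolynomial.C (a i)

lemma eval_linearForm {ι : Type*} [Fintype ι] (a c : ι → ℝ) :
    MvPolynomial.eval c (linearForm a) = ∑ i, c i * a i := by
  simp [linearForm]

lemma linearForm_ne_zero {ι : Type*} [Fintype ι] {a : ι → ℝ} (ha : a ≠ 0) : linearForm a ≠ 0 := by
  classical
  obtain ⟨i, hi⟩ := Function.ne_iff.1 ha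
  intro h
  have := eval_linearForm a (Pi.single i 1)
  rw [h] at this
  simp [Pi.single_apply] at this
  exact hi this.symm

/-- The projection of the cube `T^ι`, for `T ⊆ ℝ^d`, to `ℝ^d` with weights `c`. -/
def weightedSum {d : ℕ} {T : Set (Fin d → ℝ)} {ι : Type*} [Fintype ι] (c : ι → ℝ) (z : ι → T) :
    Fin d → ℝ :=
  ∑ i, c i • (z i : Fin d → ℝ)

lemma weightedSum_apply {d : ℕ} {T : Set (Fin d → ℝ)} {ι : Type*} [Fintype ι] (c : ι → ℝ)
    (z : ι → T) (a : Fin d) : weightedSum c z a = ∑ i, c i * (z i : Fin d → ℝ) a := by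
  simp [weightedSum, Finset.sum_apply]

/-- The permutations of `T ⊆ ℝ^d` that are restrictions of maps `p ↦ a + r • p`, with `r` of either
sign. -/
def homotheticPerms {d : ℕ} (T : Set (Fin d → ℝ)) : Set (Equiv.Perm T) :=
  {σ | ∃ r : ℝ, ∀ s t, (σ s : Fin d → ℝ) - σ t = r • ((s : Fin d → ℝ) - t)}

/-- For suitable weights, distinct points of the cube go to distinct points that are no zeros of
members of `F`, and only lines of the cube go to homothetic copies of `T`. Each condition excludes
the zeros of a nonzero polynomial in the weights: if `z` and `z'` differ in coordinate `i`, then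
`f (z, z')` at the `i`-th unit vector of weights is `f (z i, z' i)`; and being homothetic is a
system of linear equations, which must then hold in each coordinate. -/
lemma exists_generic_weights {d : ℕ} {T : Set (Fin d → ℝ)} [Finite T] {ι : Type*} [Fintype ι]
    {F : Set (MvPolynomial (Fin d ⊕ Fin d) ℝ)} (hF : F.Countable) (hFT : Respects F T) :
    ∃ c : ι → ℝ, (∀ i, 0 < c i) ∧
      (∀ z z' : ι → T, z ≠ z' → weightedSum c z ≠ weightedSum c z') ∧
      (∀ f ∈ F, ∀ z z' : ι → T, z ≠ z' →
        MvPolynomial.eval (Sum.elim (weightedSum c z) (weightedSum c z')) f ≠ 0) ∧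
      (∀ e : T → ι → T, ∀ r : ℝ,
        (∀ s t : T, weightedSum c (e s) - weightedSum c (e t) = r • ((s : Fin d → ℝ) - t)) →
          IsGMap (homotheticPerms T) e) := by
  classical
  let sub : (ι → T) → (ι → T) → MvPolynomial (Fin d ⊕ Fin d) ℝ → MvPolynomial ι ℝ := fun z z' f =>
    MvPolynomial.aeval (Sum.elim (fun a => linearForm fun i => (z i : Fin d → ℝ) a)
      fun a => linearForm fun i => (z' i : Fin d → ℝ) a) f
  have hsub : ∀ z z' f c, MvPolynomial.eval c (sub z z' f) =
      MvPolynomial.eval (Sum.elim (weightedSum c z) (weightedSum c z')) f := by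
    intro z z' f c
    have : (fun x => MvPolynomial.eval c
        ((Sum.elim (fun a => linearForm fun i => (z i : Fin d → ℝ) a)
          (fun a => linearForm fun i => (z' i : Fin d → ℝ) a) :
            Fin d ⊕ Fin d → MvPolynomial ι ℝ) x)) =
        Sum.elim (weightedSum c z) (weightedSum c z') := by
      funext x
      cases x <;> simp [eval_linearForm, weightedSum_apply]
    rw [← this]
    have hC : (MvPolynomial.eval c).comp (algebraMap ℝ (MvPolynomial ι ℝ)) = RingHom.id ℝ :=
      RingHom.ext fun r => MvPolynomial.eval_C r
    simp only [sub, MvPolynomial.map_aeval, hC]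
    rfl
  -- the coefficients of the linear equation for coordinates `a`, `b` of a homothetic copy
  let co : (T → ι → T) → T → T → T → Fin d → Fin d → ι → ℝ := fun e t₀ s t a b i =>
    ((e t i : Fin d → ℝ) a - (e t₀ i : Fin d → ℝ) a) * ((s : Fin d → ℝ) b - (t₀ : Fin d → ℝ) b) -
    ((e s i : Fin d → ℝ) b - (e t₀ i : Fin d → ℝ) b) * ((t : Fin d → ℝ) a - (t₀ : Fin d → ℝ) a)
  let 𝓛 : Set (ι → ℝ) :=
    (Set.range fun x : (ι → T) × (ι → T) × Fin d => fun i =>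
      (x.1 i : Fin d → ℝ) x.2.2 - (x.2.1 i : Fin d → ℝ) x.2.2) ∪
    Set.range fun x : (T → ι → T) × T × T × T × Fin d × Fin d =>
      co x.1 x.2.1 x.2.2.1 x.2.2.2.1 x.2.2.2.2.1 x.2.2.2.2.2
  have h𝓛 : 𝓛.Countable := ((Set.finite_range _).union (Set.finite_range _)).countable
  obtain ⟨c, hpos, hc⟩ := exists_pos_forall_eval_ne_zero
    (linearForm '' (𝓛 \ {0}) ∪ ⋃ z : (ι → T) × (ι → T), ⋃ (_ : z.1 ≠ z.2), sub z.1 z.2 '' F)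
    (((h𝓛.mono Set.sdiff_subset).image _).union
      (Set.countable_iUnion fun z => Set.countable_iUnion fun _ => hF.image _))
    (by
      rintro p (⟨a, ⟨-, ha⟩, rfl⟩ | hp)
      · exact linearForm_ne_zero ha
      · simp only [Set.mem_iUnion] at hp
        obtain ⟨z, hz, f, hf, rfl⟩ := hp
        obtain ⟨i, hi⟩ := Function.ne_iff.1 hz
        intro h
        have hsingle : ∀ w : ι → T, weightedSum (Pi.single i (1 : ℝ)) w = w i := fun w => by
          funext a
          simp [weightedSum_apply, Pi.single_apply]
        have := hsub z.1 z.2 f (Pi.single i 1)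
        rw [h, hsingle, hsingle, map_zero] at this
        exact hFT f hf _ (z.1 i).2 _ (z.2 i).2 (fun he => hi (Subtype.ext he)) this.symm)
  have hlin : ∀ a ∈ 𝓛, ∑ i, c i * a i = 0 → a = 0 := fun a ha h => by
    by_contra ha0
    exact hc _ (Or.inl ⟨a, ⟨ha, ha0⟩, rfl⟩) ((eval_linearForm a c).trans h)
  refine ⟨c, hpos, fun z z' hne h => ?_, fun f hf z z' hne => ?_, fun e r hr => ?_⟩
  · refine hne (funext fun i => Subtype.ext (funext fun a => ?_))
    have h1 := congrFun h a
    rw [weightedSum_apply, weightedSum_apply] at h1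
    have := congrFun (hlin _ (Or.inl ⟨(z, z', a), rfl⟩) (by
      simp only [mul_sub, Finset.sum_sub_distrib, h1, sub_self])) i
    exact sub_eq_zero.1 this
  · rw [← hsub]
    refine hc _ (Or.inr ?_)
    simp only [Set.mem_iUnion]
    exact ⟨(z, z'), hne, f, hf, rfl⟩
  · have hco : ∀ t₀ s t a b i, co e t₀ s t a b i = 0 := by
      intro t₀ s t a b i
      refine congrFun (hlin _ (Or.inr ⟨(e, t₀, s, t, a, b), rfl⟩) ?_) i
      have h1 := congrFun (hr t t₀) a
      have h2 := congrFun (hr s t₀) b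
      simp only [Pi.sub_apply, weightedSum_apply, Pi.smul_apply, smul_eq_mul] at h1 h2
      calc ∑ i, c i * co e t₀ s t a b i
          = (∑ i, c i * (e t i : Fin d → ℝ) a - ∑ i, c i * (e t₀ i : Fin d → ℝ) a) *
              ((s : Fin d → ℝ) b - (t₀ : Fin d → ℝ) b) -
            (∑ i, c i * (e s i : Fin d → ℝ) b - ∑ i, c i * (e t₀ i : Fin d → ℝ) b) *
              ((t : Fin d → ℝ) a - (t₀ : Fin d → ℝ) a) := by
            rw [← Finset.sum_sub_distrib, ← Finset.sum_sub_distrib, Finset.sum_mul, Finset.sum_mul,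
              ← Finset.sum_sub_distrib]
            exact Finset.sum_congr rfl fun i _ => by simp only [co]; ring
        _ = 0 := by rw [h1, h2]; ring
    intro i
    by_cases htriv : ∃ s t₀ : T, s ≠ t₀
    swap
    · by_cases hne : Nonempty T
      · obtain ⟨t₀⟩ := hne
        refine Or.inr ⟨e t₀ i, fun t => ?_⟩
        by_contra hc
        exact htriv ⟨t, t₀, fun h => hc (by rw [h])⟩
      · exact Or.inl ⟨1, ⟨0, fun s => absurd ⟨s⟩ hne⟩, fun s => absurd ⟨s⟩ hne⟩
    obtain ⟨s, t₀, hst⟩ := htriv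
    obtain ⟨b, hb⟩ := Function.ne_iff.1 fun h => hst (Subtype.ext h)
    have hb' : (s : Fin d → ℝ) b - (t₀ : Fin d → ℝ) b ≠ 0 := sub_ne_zero.2 hb
    -- the ratio of the `i`-th coordinate is read off at the points `s`, `t₀`
    obtain ⟨q, hq⟩ : ∃ q : ℝ, q = ((e s i : Fin d → ℝ) b - (e t₀ i : Fin d → ℝ) b) /
      ((s : Fin d → ℝ) b - (t₀ : Fin d → ℝ) b) := ⟨_, rfl⟩
    have hq₀ : ∀ t : T, (e t i : Fin d → ℝ) - e t₀ i = q • ((t : Fin d → ℝ) - t₀) := by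
      intro t
      funext a
      have := hco t₀ s t a b i
      simp only [co] at this
      simp only [Pi.sub_apply, Pi.smul_apply, smul_eq_mul]
      rw [hq, div_mul_eq_mul_div, eq_div_iff hb']
      linarith
    have hqq : ∀ t t' : T, (e t i : Fin d → ℝ) - e t' i = q • ((t : Fin d → ℝ) - t') := by
      intro t t'
      rw [← sub_sub_sub_cancel_right _ _ ((e t₀ i : Fin d → ℝ)), hq₀, hq₀, ← smul_sub,
        sub_sub_sub_cancel_right]
    by_cases hq0 : q = 0
    · refine Or.inr ⟨e t₀ i, fun t => Subtype.ext ?_⟩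
      have := hqq t t₀
      rw [hq0, zero_smul] at this
      exact sub_eq_zero.1 this
    · have hinj : Function.Injective fun t => e t i := fun t t' h => by
        have h1 := hqq t t'
        have h2 : e t i = e t' i := h
        rw [h2, sub_self, eq_comm, smul_eq_zero] at h1
        exact Subtype.ext (sub_eq_zero.1 (h1.resolve_left hq0))
      exact Or.inl ⟨Equiv.ofBijective _ (Finite.injective_iff_bijective.1 hinj),
        ⟨q, fun s t => hqq s t⟩, fun t => rfl⟩

end ConstrainedGallai

open ConstrainedGallai in
theorem mainTheorem5 (d : ℕ) (T : Set (Fin d → ℝ)) (hTfin : T.Finite) (hTcard : 3 ≤ T.ncard)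
    (F : Set (MvPolynomial (Fin d ⊕ Fin d) ℝ)) (hFcount : F.Countable)
    (hFT : ConstrainedGallai.Respects F T)
    (g k : ℕ) (hg : 0 < g) (hk : 0 < k) :
    ∃ X : Set (Fin d → ℝ), X.Finite ∧
      ConstrainedGallai.Respects F X ∧
      (∀ ℓ : ℕ, ℓ < g → ∀ S : Fin ℓ → Set (Fin d → ℝ),
        (∀ i, ConstrainedGallai.IsHomotheticCopy (S i) T ∧ S i ⊆ X) →
          ¬ ConstrainedGallai.IsCycle X S) ∧
      (∀ c : X → Fin k, ∃ T' : Set (Fin d → ℝ),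
        T' ⊆ X ∧ ConstrainedGallai.IsHomotheticCopy T' T ∧
          ConstrainedGallai.IsMonochromatic c T') := by
  classical
  have : Finite T := hTfin
  have hcard : 3 ≤ Nat.card T := hTcard
  have hnt : Nontrivial T := Finite.one_lt_card_iff_nontrivial.1 (by omega)
  obtain ⟨ι, hι, W, hWs, hWr⟩ := sparseRamsey hk g T hcard (homotheticPerms T)
  have := Fintype.ofFinite ι
  obtain ⟨w, hwpos, hwinj, hwF, hwG⟩ := exists_generic_weights (ι := ι) hFcount hFT
  have hinj : Function.Injective (weightedSum (T := T) w) := fun z z' h => by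
    by_contra hne
    exact hwinj z z' hne h
  refine ⟨weightedSum w '' W, (Set.toFinite W).image _, ?_, ?_, ?_⟩
  · rintro f hf _ ⟨z, -, rfl⟩ _ ⟨z', -, rfl⟩ hne
    exact hwF f hf z z' fun h => hne (by rw [h])
  · intro ℓ hℓ S hS hcyc
    -- homothetic copies of `T` in the projection of `W` come from lines of `W`
    have hline : ∀ i, ∃ s ∈ lineSets (homotheticPerms T) W, S i = weightedSum w '' s := by
      intro i
      obtain ⟨⟨h, ⟨a, r, hr, hh⟩, hSi⟩, hSX⟩ := hS i
      have hmem : ∀ t : T, ∃ z ∈ W, weightedSum w z = h t := fun t =>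
        hSX (hSi ▸ Set.mem_image_of_mem h t.2)
      choose e heW he using hmem
      refine ⟨Set.range e, ⟨e, ⟨hwG e r fun s t => ?_, fun s t hst => ?_⟩, heW, rfl⟩, ?_⟩
      · rw [he, he, hh, hh, add_sub_add_left_eq_sub, smul_sub]
      · have h1 : h s = h t := by rw [← he, ← he, hst]
        rw [hh, hh] at h1
        exact Subtype.ext (smul_right_injective _ hr.ne' (add_left_cancel h1))
      · rw [hSi, ← Set.range_comp]
        ext x
        constructor
        · rintro ⟨t, ht, rfl⟩
          exact ⟨⟨t, ht⟩, he _⟩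
        · rintro ⟨t, rfl⟩
          exact ⟨t, t.2, (he t).symm⟩
    choose s hs hSs using hline
    obtain ⟨h2, hSinj, -, x, hx, hxX, hxS⟩ := hcyc
    choose z hzW hz using hxX
    refine hWs.not_isCycle (ℓ := ℓ) (X := Set.univ) (by omega) hs
      ⟨h2, fun i j hij => hSinj (by rw [hSs, hSs, hij]), fun i => Set.subset_univ _, z,
        fun i j hij => hx (by rw [← hz, ← hz, hij]), fun i => trivial, fun i => ?_⟩
    have := hxS i
    rw [hSs, hSs, ← hz] at this
    exact ⟨hinj.mem_set_image.1 this.1, hinj.mem_set_image.1 this.2⟩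
  · intro c
    obtain ⟨e, he, heW, b, hb⟩ := hWr fun z =>
      if h : weightedSum w z ∈ weightedSum w '' W then c ⟨_, h⟩ else ⟨0, hk⟩
    refine ⟨Set.range fun t => weightedSum w (e t), ?_, ?_, b, ?_⟩
    · rintro _ ⟨t, rfl⟩
      exact Set.mem_image_of_mem _ (heW t)
    · obtain ⟨s₀, s₁, h01⟩ := exists_pair_ne T
      obtain ⟨i₀, hi₀⟩ := he.exists_id h01
      -- the active coordinates give the ratio, the constant ones the translation
      refine ⟨fun p => (∑ i, if ∀ t, e t i = t then 0 else w i • (e s₀ i : Fin d → ℝ)) +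
        (∑ i, if ∀ t, e t i = t then w i else 0) • p, ⟨_, _, ?_, fun p => rfl⟩, ?_⟩
      · refine Finset.sum_pos' (fun i _ => ?_) ⟨i₀, Finset.mem_univ _, ?_⟩
        · split_ifs
          · exact (hwpos i).le
          · exact le_rfl
        · rw [if_pos hi₀]
          exact hwpos i₀
      · have key : ∀ t : T, weightedSum w (e t) =
            (∑ i, if ∀ t, e t i = t then 0 else w i • (e s₀ i : Fin d → ℝ)) +
            (∑ i, if ∀ t, e t i = t then w i else 0) • (t : Fin d → ℝ) := by
          intro t
          rw [Finset.sum_smul, ← Finset.sum_add_distrib, weightedSum]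
          refine Finset.sum_congr rfl fun i _ => ?_
          by_cases h : ∀ t, e t i = t
          · rw [if_pos h, if_pos h, h, zero_add]
          · obtain ⟨a, ha⟩ := (he.1.id_or_const i).resolve_left h
            rw [if_neg h, if_neg h, zero_smul, add_zero, ha, ha]
        ext x
        constructor
        · rintro ⟨t, rfl⟩
          exact ⟨t, t.2, (key t).symm⟩
        · rintro ⟨t, ht, rfl⟩
          exact ⟨⟨t, ht⟩, key _⟩
    · rintro ⟨x, hx⟩ ⟨t, rfl⟩
      have := hb t
      rwa [dif_pos hx] at this
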